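/- Let $n \ge 0$. Let $R, S$ run over the (finitely many) isomorphism classes of irreducible finite-dimensional complex representations $V_R$ of the symmetric group $S_n$, let $\chi^R$ be the character of $V_R$, and let ${\sf C}(R,S,T)=\dim \mathrm{Hom}_{S_n}(V_T, V_R\otimes V_S)$ be the Kronecker coefficient, i.e. the multiplicity of $V_T$ in $V_R\otimes V_S$. For a partition $p$ of $n$ let $\tau_p\in S_n$ be a permutation of cycle type $p$, so that $(\chi^R(\tau_p))_{R,\,p\vdash n}$ is the character table of $S_n$. Let $$\mathcal K(n)=\mathrm{Span}_{\mathbb C}\Big\{\sum_{\gamma_1,\gamma_2\in S_n}\gamma_1\sigma_1\gamma_2\otimes\gamma_1\sigma_2\gamma_2\otimes\gamma_1\sigma_3\gamma_2 \;:\; \sigma_1,\sigma_2,\sigma_3\in S_n\Big\}\subset \mathbb C(S_n)^{\otimes 3},$$ on which $S_3$ acts by permuting the three tensor factors, and let $S^{(3)}_{[2,1]}(n)=\mathrm{tr}_{\mathcal K(n)}\big((12)\big)$ be the trace over $\mathcal K(n)$ of the exchange of the first two factors. Then: 1. $S^{(3)}_{[2,1]}(n)=\dfrac{1}{n!}\sum_{R}\sum_{\sigma\in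 S_n}\chi^R(\sigma^2)^2$. 2. $S^{(3)}_{[2,1]}(n)=\sum_{R,S}{\sf C}(R,R,S)$. 3. $S^{(3)}_{[2,1]}(n)=\sum_{R}\sum_{p\vdash n}\chi^R(\tau_p)$, the sum of all entries of the character table of $S_n$. 4. For every irreducible representation $S$ of $S_n$, $\ \sum_R {\sf C}(R,R,S)=\sum_{p\vdash n}\chi^S(\tau_p)$. 5. For every $\tau\in S_n$, the number of square roots of $\tau$ is $\ \#\{\sigma\in S_n:\sigma^2=\tau\}=\sum_S\chi^S(\tau)$. -/

import Mathlib

open Equiv CategoryTheory MonoidalCategory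
open scoped Nat

noncomputable section

namespace SymChar

/-! ### Irreducible representations of the symmetric group and its character table -/

/-- Isomorphism of irreducible finite-dimensional complex representations of `S_n`. -/
instance irrepSetoid (n : ℕ) : Setoid {V : FDRep ℂ (Perm (Fin n)) // Simple V} where
  r V W := Nonempty (V.1 ≅ W.1)
  iseqv :=
    ⟨fun V => ⟨Iso.refl V.1⟩, fun ⟨i⟩ => ⟨i.symm⟩, fun ⟨i⟩ ⟨j⟩ => ⟨i.trans j⟩⟩

/-- The set of irreps `R` of `S_n`: isomorphism classes of irreducible finite-dimensional complex
representations. -/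
def Irrep (n : ℕ) : Type 1 := Quotient (irrepSetoid n)

/-- A representation `V_R` in the isomorphism class `R`. -/
def Irrep.rep {n : ℕ} (R : Irrep n) : FDRep ℂ (Perm (Fin n)) := (Quotient.out R).1

instance {n : ℕ} (R : Irrep n) : Simple R.rep := (Quotient.out R).2

/-- The irreducible character `χ^R`. -/
def chi {n : ℕ} (R : Irrep n) (σ : Perm (Fin n)) : ℂ := R.rep.character σ

theorem Irrep.eq_of_iso {n : ℕ} {R S : Irrep n} (h : Nonempty (R.rep ≅ S.rep)) : R = S :=
  Quotient.out_equiv_out.mp h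

/-- The irreducible characters are linearly independent; hence there are finitely many irreps. -/
theorem linearIndependent_chi (n : ℕ) :
    LinearIndependent ℂ (fun R : Irrep n => (chi R : Perm (Fin n) → ℂ)) := by
  classical
  have : Invertible (Nat.card (Perm (Fin n)) : ℂ) :=
    invertibleOfNonzero (by exact_mod_cast Nat.card_pos.ne')
  have key : ∀ R S : Irrep n, (Nat.card (Perm (Fin n)) : ℂ)⁻¹ *
      ∑ g : Perm (Fin n), chi R g * chi S g⁻¹ = if R = S then 1 else 0 := by
    intro R S
    have h := FDRep.char_orthonormal R.rep S.rep
    rw [show (∑ g : Perm (Fin n), chi R g * chi S g⁻¹) =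
      ∑ g : Perm (Fin n), R.rep.character g * S.rep.character g⁻¹ from rfl, h]
    by_cases hRS : R = S
    · subst hRS; simp [Nonempty.intro (Iso.refl R.rep)]
    · have : ¬ Nonempty (R.rep ≅ S.rep) := fun h => hRS (Irrep.eq_of_iso h)
      rw [if_neg this, if_neg hRS]
  rw [linearIndependent_iff']
  intro s c hc S hS
  have h0 : ∀ g, ∑ R ∈ s, c R * chi R g = 0 := fun g => by
    simpa using congrFun hc g
  have h1 : ∑ R ∈ s, c R * ((Nat.card (Perm (Fin n)) : ℂ)⁻¹ *
      ∑ g : Perm (Fin n), chi R g * chi S g⁻¹) = 0 := by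
    calc _ = (Nat.card (Perm (Fin n)) : ℂ)⁻¹ *
          ∑ g : Perm (Fin n), (∑ R ∈ s, c R * chi R g) * chi S g⁻¹ := by
            simp only [Finset.mul_sum, Finset.sum_mul]
            rw [Finset.sum_comm]
            refine Finset.sum_congr rfl fun g _ => Finset.sum_congr rfl fun R _ => by ring
      _ = 0 := by simp [h0]
  simp only [key] at h1
  simpa [hS] using h1

instance (n : ℕ) : Finite (Irrep n) := (linearIndependent_chi n).finite

instance (n : ℕ) : Fintype (Irrep n) := Fintype.ofFinite _

/-- The Kronecker coefficient `C(R, S, T)`: the multiplicity of the irrep `T` in `V_R ⊗ V_S`, that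
is, the dimension of the space of `S_n`-equivariant maps from `V_T` to `V_R ⊗ V_S`. -/
def kron {n : ℕ} (R S T : Irrep n) : ℕ := Module.finrank ℂ (T.rep ⟶ R.rep ⊗ S.rep)

/-- For every partition `p` of `n` there is a permutation with cycle lengths `p`
(`Equiv.Perm.partition` records fixed points as parts equal to `1`). -/
theorem exists_perm_of_partition {n : ℕ} (p : n.Partition) :
    ∃ σ : Perm (Fin n), σ.partition.parts = p.parts := by
  have hsplit : p.parts.filter (2 ≤ ·) + p.parts.filter (fun a => ¬ 2 ≤ a) = p.parts :=
    Multiset.filter_add_not _ _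
  have hone : p.parts.filter (fun a => ¬ 2 ≤ a) =
      Multiset.replicate (p.parts.filter (fun a => ¬ 2 ≤ a)).card 1 := by
    rw [Multiset.eq_replicate_card]
    intro b hb
    have h := Multiset.mem_filter.mp hb
    have := p.parts_pos h.1
    have := h.2
    omega
  have hsum : (p.parts.filter (2 ≤ ·)).sum + (p.parts.filter (fun a => ¬ 2 ≤ a)).card = n := by
    have h := congrArg Multiset.sum hsplit
    rw [Multiset.sum_add, hone, Multiset.sum_replicate, p.parts_sum] at h
    simpa using h
  obtain ⟨σ, hσ⟩ := (Equiv.Perm.exists_with_cycleType_iff (α := Fin n)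
    (m := p.parts.filter (2 ≤ ·))).mpr
      ⟨by rw [Fintype.card_fin]; omega, fun a ha => (Multiset.mem_filter.mp ha).2⟩
  refine ⟨σ, ?_⟩
  have hc : Fintype.card (Fin n) - σ.support.card =
      (p.parts.filter (fun a => ¬ 2 ≤ a)).card := by
    rw [← Equiv.Perm.sum_cycleType, hσ, Fintype.card_fin]; omega
  rw [Equiv.Perm.parts_partition, hc, hσ, ← hone, hsplit]

/-- A permutation `τ_p` in the conjugacy class of `S_n` specified by the partition `p` of `n`. -/
def tau {n : ℕ} (p : n.Partition) : Perm (Fin n) := (exists_perm_of_partition p).choose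

/-- The character table of `S_n`: the rows are indexed by the irreps and the columns by the
conjugacy classes, that is, by the partitions of `n`. -/
def charTable (n : ℕ) : Matrix (Irrep n) n.Partition ℂ := Matrix.of fun R p => chi R (tau p)

/-- The entries of the character table do not depend on the representatives `tau p`. -/
theorem charTable_eq {n : ℕ} (R : Irrep n) (p : n.Partition) (σ : Perm (Fin n))
    (hσ : σ.partition.parts = p.parts) : charTable n R p = chi R σ := by
  have h : IsConj σ (tau p) := Equiv.Perm.partition_eq_of_isConj.mpr
    (Nat.Partition.ext (hσ.trans (exists_perm_of_partition p).choose_spec.symm))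
  obtain ⟨g, hg⟩ := isConj_iff.mp h
  exact (congrArg (chi R) hg).symm.trans (FDRep.char_conj R.rep σ g)

/-! ### The algebra of `3`-coloured graphs and its colour-exchange symmetry -/

/-- The group algebra `ℂ(S_n) ⊗ ℂ(S_n) ⊗ ℂ(S_n)`, realised as the group algebra of
`S_n × S_n × S_n`. -/
abbrev TripleAlgebra (n : ℕ) : Type := MonoidAlgebra ℂ (Fin 3 → Perm (Fin n))

/-- The sum of all `γ₁ σ₁ γ₂ ⊗ γ₁ σ₂ γ₂ ⊗ γ₁ σ₃ γ₂` over `γ₁, γ₂ ∈ S_n`. -/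
def graphElement {n : ℕ} (σ : Fin 3 → Perm (Fin n)) : TripleAlgebra n :=
  ∑ γ₁ : Perm (Fin n), ∑ γ₂ : Perm (Fin n), MonoidAlgebra.single (fun i => γ₁ * σ i * γ₂) 1

/-- The vector space `K(n)` of `3`-coloured graphs: the part of `ℂ(S_n)^{⊗ 3}` that is invariant
under the diagonal left and right actions of `S_n`. -/
def graphSpace (n : ℕ) : Submodule ℂ (TripleAlgebra n) :=
  Submodule.span ℂ (Set.range graphElement)

/-- The action of `α ∈ S_3` on `ℂ(S_n)^{⊗ 3}` by permutation of the tensor slots. -/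
def slotPerm (n : ℕ) (α : Perm (Fin 3)) : TripleAlgebra n →ₗ[ℂ] TripleAlgebra n :=
  (MonoidAlgebra.domCongr ℂ ℂ
    (MulEquiv.arrowCongr α (MulEquiv.refl (Perm (Fin n))))).toLinearMap

theorem slotPerm_single {n : ℕ} (α : Perm (Fin 3)) (σ : Fin 3 → Perm (Fin n)) (c : ℂ) :
    slotPerm n α (MonoidAlgebra.single σ c) =
      MonoidAlgebra.single (fun i => σ (α⁻¹ i)) c := by
  simp only [slotPerm, AlgEquiv.toLinearMap_apply, MonoidAlgebra.domCongr_single]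
  rfl

theorem slotPerm_mem {n : ℕ} (α : Perm (Fin 3)) :
    ∀ x ∈ graphSpace n, slotPerm n α x ∈ graphSpace n := by
  intro x hx
  have h : graphSpace n ≤ (graphSpace n).comap (slotPerm n α) := by
    refine Submodule.span_le.mpr ?_
    rintro _ ⟨σ, rfl⟩
    refine Submodule.subset_span ⟨fun i => σ (α⁻¹ i), ?_⟩
    simp only [graphElement, map_sum, slotPerm_single]
  exact h hx

/-- `S^{(3)}_p(n)`, the trace over `K(n)` of a permutation `α ∈ S_3` of the three colours, for `p`
the cycle type of `α`. -/
def colorTrace (n : ℕ) (α : Perm (Fin 3)) : ℂ :=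
  LinearMap.trace ℂ (graphSpace n) ((slotPerm n α).restrict (slotPerm_mem α))

/-- `S^{(3)}_{[2,1]}(n)`: the trace over `K(n)` of the exchange of two colours. -/
def S21 (n : ℕ) : ℂ := colorTrace n (Equiv.swap 0 1)

end SymChar

end

/-! Averaging over the two diagonal actions is, up to the factor `(n!)^2`, a projection onto `K(n)`,
so the trace of the exchange on `K(n)` is a trace on the whole triple algebra, which counts fixed
points. The third slot determines the right multiplier, and the count becomes `S21 n = (1/n!) ∑ γ,
|C(γ^2)|`, with `C` the centralizer. Column orthogonality, `|C(τ)| = ∑ R, χ^R(τ)^2`, gives claim 1.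
Averaging `χ^S` times centralizer orders gives the sum of `χ^S` over classes, which is claim 4.
Collecting the `γ` with `γ^2 = τ` and inserting claim 5 gives claim 3; claim 2 follows from 3 and 4.

The deep point is claim 5: the number of square roots is `∑ R, ε_R χ^R` with Frobenius–Schur
indicators `ε_R = ±1`, so every `ε_R` must be shown to be `1`. This goes by induction on `n`
(`indicator_eq_one`). With `m(V,W)` the branching multiplicities from `S_{n+1}` to `S_n`, and `ε_W =
1` by induction, both `∑ m^2` and `∑ ε_V m` are averages over `h ∈ S_n` of counts in `S_{n+1}`: of
elements commuting with `h`, and of square roots of `h^2`. The totals agree because each `y ∈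
S_{n+1}` is inverted by some element of `S_n`. Hence `∑ (m^2 - ε_V m) = 0` with nonnegative terms;
each `V` has some `m > 0`, which forces `ε_V = 1`. -/

noncomputable section

namespace SymChar

/-! ### Class functions on a finite group -/

/-- The linear operator `∑ g, f g • ρ g` attached to a function `f` on the group. -/
def groupOperator {G V : Type*} [Group G] [Fintype G] [AddCommGroup V] [Module ℂ V]
    (ρ : Representation ℂ G V) (f : G → ℂ) : V →ₗ[ℂ] V := ∑ g, f g • ρ g

/-- The operator attached to a class function is an intertwining map. -/
theorem groupOperator_comm {G V : Type*} [Group G] [Fintype G] [AddCommGroup V] [Module ℂ V]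
    (ρ : Representation ℂ G V) {f : G → ℂ} (hf : ∀ x g, f (x * g * x⁻¹) = f g) (x : G) :
    groupOperator ρ f ∘ₗ ρ x = ρ x ∘ₗ groupOperator ρ f := by
  change groupOperator ρ f * ρ x = ρ x * groupOperator ρ f
  simp only [groupOperator, Finset.sum_mul, Finset.mul_sum, smul_mul_assoc, mul_smul_comm,
    ← map_mul]
  refine Fintype.sum_equiv (MulAut.conj x⁻¹).toEquiv _ _ fun g => ?_
  have h : (MulAut.conj x⁻¹).toEquiv g = x⁻¹ * g * x⁻¹⁻¹ := rfl
  rw [h, hf]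
  congr 2
  group

theorem simple_of_isIrreducible {G V : Type} [Group G] [Fintype G] [AddCommGroup V] [Module ℂ V]
    [FiniteDimensional ℂ V] (ρ : Representation ℂ G V) [ρ.IsIrreducible] :
    Simple (FDRep.of ρ) := by
  have : Invertible (Nat.card G : ℂ) :=
    invertibleOfNonzero (by exact_mod_cast Nat.card_pos.ne')
  rw [FDRep.simple_iff_char_is_norm_one]
  have h := Representation.char_orthonormal ρ ρ
  rw [if_pos ⟨Representation.Equiv.refl ρ⟩, inv_mul_eq_one₀ (Invertible.ne_zero _)] at h
  exact h.symm

/-- A class function orthogonal to an irreducible character acts by zero. -/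
theorem groupOperator_eq_zero {G V : Type*} [Group G] [Fintype G] [AddCommGroup V] [Module ℂ V]
    [FiniteDimensional ℂ V] (ρ : Representation ℂ G V) [ρ.IsIrreducible] {f : G → ℂ}
    (hf : ∀ x g, f (x * g * x⁻¹) = f g) (h : ∑ g, f g * ρ.character g = 0) :
    groupOperator ρ f = 0 := by
  let T : Representation.IntertwiningMap ρ ρ := ⟨groupOperator ρ f, groupOperator_comm ρ hf⟩
  obtain ⟨c, hc⟩ := (Representation.IsIrreducible.algebraMap_intertwiningMap_bijective_of_isAlgClosed
    (ρ := ρ)).2 T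
  have hc' : groupOperator ρ f = c • LinearMap.id := by
    have := congrArg Representation.IntertwiningMap.toLinearMap hc
    rw [show groupOperator ρ f = T.toLinearMap from rfl, ← this]
    rfl
  have htr : LinearMap.trace ℂ V (groupOperator ρ f) = 0 := by
    simpa [groupOperator, Representation.character] using h
  -- By Schur the operator is a scalar `c`, and its trace `c * dim V` vanishes.
  rw [hc', map_smul, LinearMap.trace_id, smul_eq_mul, mul_eq_zero] at htr
  rcases htr with h0 | h0
  · rw [hc', h0, zero_smul]
  · have : Subsingleton V := Module.finrank_zero_iff.mp (by exact_mod_cast h0)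
    exact LinearMap.ext fun v => Subsingleton.elim _ _

/-- The representation on a simple module over the group algebra is irreducible. -/
theorem isIrreducible_ofModule' {G M : Type*} [Group G] [AddCommGroup M] [Module ℂ M]
    [Module (MonoidAlgebra ℂ G) M] [IsScalarTower ℂ (MonoidAlgebra ℂ G) M]
    [IsSimpleModule (MonoidAlgebra ℂ G) M] :
    (Representation.ofModule' (k := ℂ) (G := G) M).IsIrreducible := by
  rw [Representation.irreducible_iff_isSimpleModule_asModule]
  let ρ := Representation.ofModule' (k := ℂ) (G := G) M
  let e : ρ.asModule ≃ₗ[MonoidAlgebra ℂ G] M :=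
    { ρ.asModuleEquiv.toAddEquiv with
      map_smul' := fun r x => by
        have h : ρ.asAlgebraHom = Algebra.lsmul ℂ ℂ M :=
          (MonoidAlgebra.lift ℂ (M →ₗ[ℂ] M) G).apply_symm_apply _
        change ρ.asModuleEquiv (r • x) = r • ρ.asModuleEquiv x
        rw [Representation.asModuleEquiv_map_smul, h]
        rfl }
  exact IsSimpleModule.congr e

/-- A class function orthogonal to all irreducible characters annihilates all simple modules. -/
theorem smul_eq_zero_of_orthogonal {G : Type} [Group G] [Fintype G] {f : G → ℂ}
    (hf : ∀ x g, f (x * g * x⁻¹) = f g)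
    (h : ∀ V : FDRep ℂ G, Simple V → ∑ g, f g * V.character g = 0)
    (M : Type) [AddCommGroup M] [Module ℂ M] [FiniteDimensional ℂ M]
    [Module (MonoidAlgebra ℂ G) M] [IsScalarTower ℂ (MonoidAlgebra ℂ G) M]
    [IsSimpleModule (MonoidAlgebra ℂ G) M] (m : M) :
    (∑ g, MonoidAlgebra.single g (f g) : MonoidAlgebra ℂ G) • m = 0 := by
  let ρ := Representation.ofModule' (k := ℂ) (G := G) M
  have hρ : ρ.IsIrreducible := isIrreducible_ofModule'
  have h0 := groupOperator_eq_zero ρ hf (h (FDRep.of ρ) (simple_of_isIrreducible ρ))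
  have h1 : groupOperator ρ f =
      ρ.asAlgebraHom (∑ g, MonoidAlgebra.single g (f g) : MonoidAlgebra ℂ G) := by
    simp [groupOperator, Representation.asAlgebraHom_single]
  have h2 : ρ.asAlgebraHom = Algebra.lsmul ℂ ℂ M :=
    (MonoidAlgebra.lift ℂ (M →ₗ[ℂ] M) G).apply_symm_apply _
  rw [h2, h0] at h1
  exact (LinearMap.congr_fun h1 m).symm

/-- A class function orthogonal to all irreducible characters vanishes. -/
theorem eq_zero_of_orthogonal {G : Type} [Group G] [Fintype G] {f : G → ℂ}
    (hf : ∀ x g, f (x * g * x⁻¹) = f g)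
    (h : ∀ V : FDRep ℂ G, Simple V → ∑ g, f g * V.character g = 0) : f = 0 := by
  classical
  have hN : NeZero (Nat.card G : ℂ) := ⟨by exact_mod_cast Nat.card_pos.ne'⟩
  -- Killing the class of `1` modulo each maximal left ideal puts the element in the Jacobson
  -- radical, which is zero by Maschke.
  have ha : (∑ g, MonoidAlgebra.single g (f g) : MonoidAlgebra ℂ G) ∈
      Module.jacobson (MonoidAlgebra ℂ G) (MonoidAlgebra ℂ G) := by
    refine Submodule.mem_sInf.mpr fun m hm => ?_
    have hM : IsSimpleModule (MonoidAlgebra ℂ G) (MonoidAlgebra ℂ G ⧸ m) :=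
      isSimpleModule_iff_isCoatom.mpr hm
    have hfin : Module.Finite ℂ (MonoidAlgebra ℂ G) :=
      Module.Finite.of_basis (MonoidAlgebra.basis G ℂ)
    have hfin' : Module.Finite ℂ (MonoidAlgebra ℂ G ⧸ m) :=
      Module.Finite.trans (MonoidAlgebra ℂ G) _
    have h1 := smul_eq_zero_of_orthogonal hf h (MonoidAlgebra ℂ G ⧸ m) (Submodule.Quotient.mk 1)
    rw [← Submodule.Quotient.mk_smul, smul_eq_mul, mul_one] at h1
    exact (Submodule.Quotient.mk_eq_zero m).mp h1
  rw [IsSemisimpleModule.jacobson_eq_bot, Submodule.mem_bot] at ha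
  funext g
  have := congrArg (fun b => b.coeff g) ha
  simpa [MonoidAlgebra.coeff_sum, Finsupp.single_apply] using this

/-! ### Conjugating a permutation to its inverse -/

/-- A permutation is conjugate to its inverse by a permutation fixing a given point. -/
theorem exists_conj_inv_of_fixed {α : Type*} (g : Perm α) (x : α) :
    ∃ h : Perm α, h x = x ∧ h * g * h⁻¹ = g⁻¹ := by
  classical
  -- A base point on each cycle, chosen to be `x` on the cycle of `x`. The conjugator reflects each
  -- cycle about its base point, `g^i r ↦ g^(-i) r`.
  let r : α → α := fun y => if g.SameCycle x y then x else
    Quotient.out (Quotient.mk (Perm.SameCycle.setoid g) y)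
  have hr : ∀ y, g.SameCycle (r y) y := fun y => by
    by_cases h : g.SameCycle x y
    · simpa only [r, if_pos h] using h
    · simp only [r, if_neg h]
      exact Quotient.mk_out (s := Perm.SameCycle.setoid g) y
  have hr' : ∀ y z, g.SameCycle y z → r y = r z := fun y z h => by
    have h1 : g.SameCycle x y ↔ g.SameCycle x z := ⟨fun k => k.trans h, fun k => k.trans h.symm⟩
    have h2 : Quotient.mk (Perm.SameCycle.setoid g) y = Quotient.mk (Perm.SameCycle.setoid g) z :=
      Quotient.sound h
    simp only [r, h1, h2]
  choose i hi using hr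
  let f : α → α := fun y => (g ^ (-i y)) (r y)
  -- The reflection does not depend on the exponent, which is not unique on a finite cycle.
  have key : ∀ y (k : ℤ), (g ^ k) (r y) = y → f y = (g ^ (-k)) (r y) := fun y k hk => by
    have h : (g ^ (i y)) (r y) = (g ^ k) (r y) := (hi y).trans hk.symm
    have h' := congrArg (g ^ (-k - i y)) h
    rw [← Perm.mul_apply, ← Perm.mul_apply, ← zpow_add, ← zpow_add] at h'
    rw [sub_add_cancel, show -k - i y + k = -i y by ring] at h'
    exact h'.symm
  have hf : ∀ y, f (f y) = y := fun y => by
    have h1 : r (f y) = r y := hr' _ _ (by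
      refine Perm.SameCycle.trans ?_ ⟨i y, hi y⟩
      exact Perm.SameCycle.symm ⟨-i y, rfl⟩)
    rw [key (f y) (-i y) (by rw [h1]), h1, neg_neg, hi]
  have hg : ∀ y, f (g y) = g⁻¹ (f y) := fun y => by
    have h1 : r (g y) = r y := hr' _ _ (Perm.SameCycle.symm ⟨1, by simp⟩)
    rw [key (g y) (1 + i y) (by rw [h1, zpow_add, Perm.mul_apply, hi, zpow_one]), h1, neg_add,
      zpow_add, Perm.mul_apply, zpow_neg_one]
  refine ⟨⟨f, f, hf, hf⟩, ?_, ?_⟩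
  · have h1 : r x = x := if_pos (Perm.SameCycle.refl g x)
    have := key x 0 (by simp [h1])
    simpa [h1] using this
  · rw [mul_inv_eq_iff_eq_mul]
    exact Equiv.ext hg

variable {n : ℕ}

/-- Permutations are conjugate to their inverses, so inner products of characters can be written
without inverses or complex conjugates. -/
theorem character_inv (V : FDRep ℂ (Perm (Fin n))) (g : Perm (Fin n)) :
    V.character g⁻¹ = V.character g := by
  have : ∃ h : Perm (Fin n), h * g * h⁻¹ = g⁻¹ := by
    cases n with
    | zero => exact ⟨1, Subsingleton.elim _ _⟩
    | succ n => exact (exists_conj_inv_of_fixed g 0).imp fun _ h => h.2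
  obtain ⟨h, hh⟩ := this
  rw [← hh, FDRep.char_conj]

theorem chi_conj (R : Irrep n) (x g : Perm (Fin n)) : chi R (x * g * x⁻¹) = chi R g :=
  FDRep.char_conj _ _ _

/-! ### Orthogonality relations -/

theorem card_perm_ne_zero (n : ℕ) : (Nat.card (Perm (Fin n)) : ℂ) ≠ 0 := by
  exact_mod_cast Nat.card_pos.ne'

/-- The dimension of a space of intertwiners in terms of characters. -/
theorem finrank_hom_eq (V W : FDRep ℂ (Perm (Fin n))) :
    (Module.finrank ℂ (V ⟶ W) : ℂ) =
      (Nat.card (Perm (Fin n)) : ℂ)⁻¹ * ∑ g, W.character g * V.character g := by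
  have : Invertible (Nat.card (Perm (Fin n)) : ℂ) := invertibleOfNonzero (card_perm_ne_zero n)
  rw [← FDRep.scalar_product_char_eq_finrank_equivariant]
  simp only [character_inv]

open Classical in
theorem sum_chi_mul_chi (R S : Irrep n) :
    ∑ g, chi R g * chi S g = if R = S then (Nat.card (Perm (Fin n)) : ℂ) else 0 := by
  have : Invertible (Nat.card (Perm (Fin n)) : ℂ) := invertibleOfNonzero (card_perm_ne_zero n)
  have h := FDRep.char_orthonormal R.rep S.rep
  simp only [character_inv] at h
  change (Nat.card (Perm (Fin n)) : ℂ)⁻¹ * ∑ g, chi R g * chi S g = _ at h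
  rw [inv_mul_eq_iff_eq_mul₀ (card_perm_ne_zero n)] at h
  rw [h]
  by_cases hRS : R = S
  · subst hRS
    rw [if_pos ⟨Iso.refl _⟩, if_pos rfl, mul_one]
  · rw [if_neg fun h => hRS (Irrep.eq_of_iso h), if_neg hRS, mul_zero]

theorem exists_chi_eq_character (V : FDRep ℂ (Perm (Fin n))) [hV : Simple V] :
    ∃ R : Irrep n, chi R = V.character := by
  refine ⟨Quotient.mk _ ⟨V, hV⟩, ?_⟩
  obtain ⟨i⟩ : Nonempty ((Quotient.out (Quotient.mk (irrepSetoid n) ⟨V, hV⟩)).1 ≅ V) :=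
    Quotient.mk_out (s := irrepSetoid n) ⟨V, hV⟩
  exact FDRep.char_iso i

/-- A class function is determined by its inner products with the irreducible characters. -/
theorem classFunction_expansion {f : Perm (Fin n) → ℂ} (hf : ∀ x g, f (x * g * x⁻¹) = f g)
    (g : Perm (Fin n)) :
    f g = ∑ R, ((Nat.card (Perm (Fin n)) : ℂ)⁻¹ * ∑ h, f h * chi R h) * chi R g := by
  classical
  let c : Irrep n → ℂ := fun R => (Nat.card (Perm (Fin n)) : ℂ)⁻¹ * ∑ h, f h * chi R h
  have h0 : (fun g => f g - ∑ R, c R * chi R g) = 0 := by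
    refine eq_zero_of_orthogonal (fun x g => by simp only [hf, chi_conj]) fun V hV => ?_
    obtain ⟨S, hS⟩ := exists_chi_eq_character V
    rw [← hS]
    simp only [sub_mul, Finset.sum_sub_distrib, Finset.sum_mul]
    rw [Finset.sum_comm]
    simp only [mul_assoc, ← Finset.mul_sum, sum_chi_mul_chi]
    simp only [mul_ite, mul_zero, Finset.sum_ite_eq', Finset.mem_univ, if_true, c]
    rw [mul_right_comm, inv_mul_cancel₀ (card_perm_ne_zero n), one_mul, sub_self]
  exact sub_eq_zero.mp (congrFun h0 g)

/-- Column orthogonality. -/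
theorem sum_chi_mul_chi_column (g h : Perm (Fin n)) :
    ∑ R : Irrep n, chi R g * chi R h =
      ((Finset.univ.filter fun x : Perm (Fin n) => x * h = g * x).card : ℂ) := by
  classical
  -- As a class function of `g`, the number of `x` conjugating `h` to `g` has coefficient `χ^R(h)`
  -- at `R`.
  let f : Perm (Fin n) → ℂ := fun g =>
    ((Finset.univ.filter fun x : Perm (Fin n) => x * h = g * x).card : ℂ)
  have hf : ∀ x g, f (x * g * x⁻¹) = f g := fun x g => by
    simp only [f]
    congr 1
    refine Finset.card_equiv (Equiv.mulLeft x⁻¹) fun y => ?_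
    simp only [Finset.mem_filter, Finset.mem_univ, true_and, Equiv.coe_mulLeft]
    constructor
    · intro e
      rw [mul_assoc, e]; group
    · intro e
      have := congrArg (x * ·) e
      simpa [mul_assoc] using this
  have hsum : ∀ R : Irrep n, ∑ g, f g * chi R g = Nat.card (Perm (Fin n)) * chi R h := fun R => by
    calc ∑ g, f g * chi R g
        = ∑ g, ∑ x : Perm (Fin n), if g = x * h * x⁻¹ then chi R g else 0 := by
          refine Finset.sum_congr rfl fun g _ => ?_
          simp only [f, Finset.card_filter, Nat.cast_sum, Finset.sum_mul]
          refine Finset.sum_congr rfl fun x _ => ?_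
          have : x * h = g * x ↔ g = x * h * x⁻¹ := by rw [eq_mul_inv_iff_mul_eq, eq_comm]
          simp [this]
      _ = _ := by
          rw [Finset.sum_comm]
          simp [chi_conj, Nat.card_eq_fintype_card]
  have := classFunction_expansion hf g
  simp only [hsum, inv_mul_cancel_left₀ (card_perm_ne_zero n)] at this
  rw [show ((Finset.univ.filter fun x : Perm (Fin n) => x * h = g * x).card : ℂ) = f g from rfl,
    this]
  exact Finset.sum_congr rfl fun R _ => mul_comm _ _

/-! ### Frobenius–Schur indicators -/

theorem exists_nat_trace_eq {V : Type*} [AddCommGroup V] [Module ℂ V] [FiniteDimensional ℂ V]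
    {e : V →ₗ[ℂ] V} (he : IsIdempotentElem e) : ∃ k : ℕ, LinearMap.trace ℂ V e = k :=
  ⟨_, (LinearMap.IsIdempotentElem.isProj_range e he).trace⟩

theorem exists_nat_matrix_trace_eq {ι : Type*} [Fintype ι] [DecidableEq ι] {M : Matrix ι ι ℂ}
    (hM : M * M = M) : ∃ k : ℕ, M.trace = k := by
  obtain ⟨k, hk⟩ := exists_nat_trace_eq (e := Matrix.toLin' M)
    (by rw [IsIdempotentElem, Module.End.mul_eq_comp, ← Matrix.toLin'_mul, hM])
  exact ⟨k, by rw [← hk, Matrix.trace_toLin'_eq]⟩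

/-- If `P` is an idempotent of trace one commuting with an involution `T`, then the trace of
`T * P` is a sign. -/
theorem trace_involution_mul {ι : Type*} [Fintype ι] [DecidableEq ι] {P T : Matrix ι ι ℂ}
    (hP : P * P = P) (hT : T * T = 1) (hTP : T * P = P * T) (htr : P.trace = 1) :
    (T * P).trace = 1 ∨ (T * P).trace = -1 := by
  have hTPP : T * P * P = T * P := by rw [mul_assoc, hP]
  have hPTP : P * (T * P) = T * P := by rw [← mul_assoc, ← hTP, hTPP]
  have hTPTP : T * P * (T * P) = P := by rw [mul_assoc, hPTP, ← mul_assoc, hT, one_mul]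
  -- The two eigenparts `(P ± TP)/2` are idempotents, so their traces are naturals `a`, `b` with `a
  -- + b = 1`, and the trace of `TP` is `a - b`.
  obtain ⟨a, ha⟩ := exists_nat_matrix_trace_eq (M := (2⁻¹ : ℂ) • (P + T * P)) (by
    rw [smul_mul_smul_comm, add_mul, mul_add, mul_add, hP, hPTP, hTPP, hTPTP,
      add_comm (T * P) P, ← two_smul ℂ (P + T * P), smul_smul]
    norm_num)
  obtain ⟨b, hb⟩ := exists_nat_matrix_trace_eq (M := (2⁻¹ : ℂ) • (P - T * P)) (by
    rw [smul_mul_smul_comm, sub_mul, mul_sub, mul_sub, hP, hPTP, hTPP, hTPTP,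
      ← neg_sub P (T * P), sub_neg_eq_add, ← two_smul ℂ (P - T * P), smul_smul]
    norm_num)
  rw [Matrix.trace_smul, Matrix.trace_add, htr, smul_eq_mul] at ha
  rw [Matrix.trace_smul, Matrix.trace_sub, htr, smul_eq_mul] at hb
  have hab : a + b = 1 := by
    have : (a : ℂ) + b = 1 := by rw [← ha, ← hb]; ring
    exact_mod_cast this
  have ht : (T * P).trace = 2 * a - 1 := by rw [← ha]; ring
  rcases (by omega : a = 0 ∨ a = 1) with rfl | rfl
  · right; rw [ht]; norm_num
  · left; rw [ht]; norm_num

/-- The Frobenius–Schur indicator of a matrix representation whose tensor square contains the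
trivial representation exactly once. -/
theorem frobeniusSchur_matrix {G ι : Type*} [Group G] [Fintype G] [Fintype ι] [DecidableEq ι]
    (A : G →* Matrix ι ι ℂ)
    (h : (Nat.card G : ℂ)⁻¹ * ∑ g, (A g).trace * (A g).trace = 1) :
    (Nat.card G : ℂ)⁻¹ * ∑ g, (A (g ^ 2)).trace = 1 ∨
      (Nat.card G : ℂ)⁻¹ * ∑ g, (A (g ^ 2)).trace = -1 := by
  have hN : (Nat.card G : ℂ) ≠ 0 := by exact_mod_cast Nat.card_pos.ne'
  let K : G → Matrix (ι × ι) (ι × ι) ℂ := fun g => Matrix.kroneckerMap (· * ·) (A g) (A g)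
  have hK : ∀ x y, K x * K y = K (x * y) := fun x y => by
    simp only [K, map_mul]
    exact (Matrix.mul_kronecker_mul _ _ _ _).symm
  -- `P` projects onto the invariants of the tensor square, a line by hypothesis, and `T` is the
  -- flip; the trace of `T * K g` is that of `A (g ^ 2)`.
  let P : Matrix (ι × ι) (ι × ι) ℂ := (Nat.card G : ℂ)⁻¹ • ∑ g, K g
  let T : Matrix (ι × ι) (ι × ι) ℂ := (Equiv.prodComm ι ι).toPEquiv.toMatrix
  have hT : ∀ M : Matrix (ι × ι) (ι × ι) ℂ, T * M = M.submatrix Prod.swap id := fun M =>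
    PEquiv.toMatrix_toPEquiv_mul _ _
  have hT' : ∀ M : Matrix (ι × ι) (ι × ι) ℂ, M * T = M.submatrix id Prod.swap := fun M =>
    PEquiv.mul_toMatrix_toPEquiv _ _
  have hTK : ∀ g, T * K g = K g * T := fun g => by
    rw [hT, hT']
    ext i j
    simp [K, mul_comm]
  have hTT : T * T = 1 := by
    rw [hT]
    ext i j
    simp [T, PEquiv.toMatrix_apply, Matrix.one_apply, Prod.ext_iff]
  have hP : P * P = P := by
    have h1 : ∀ x, K x * ∑ g, K g = ∑ g, K g := fun x => by
      simp only [Finset.mul_sum, hK]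
      exact Fintype.sum_equiv (Equiv.mulLeft x) _ _ fun g => rfl
    simp only [P, smul_mul_smul_comm, Finset.sum_mul, h1]
    rw [Finset.sum_const, Finset.card_univ, ← Nat.card_eq_fintype_card, ← Nat.cast_smul_eq_nsmul ℂ,
      smul_smul, mul_assoc, inv_mul_cancel₀ hN, mul_one]
  have hTP : T * P = P * T := by
    simp only [P, mul_smul_comm, smul_mul_assoc, Finset.mul_sum, Finset.sum_mul, hTK]
  have htr : P.trace = 1 := by
    rw [← h]
    simp only [P, K, Matrix.trace_smul, Matrix.trace_sum, smul_eq_mul]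
    congr 1
    exact Finset.sum_congr rfl fun g _ => Matrix.trace_kronecker _ _
  have hTPtr : (T * P).trace = (Nat.card G : ℂ)⁻¹ * ∑ g, (A (g ^ 2)).trace := by
    simp only [P, mul_smul_comm, Finset.mul_sum, Matrix.trace_smul, Matrix.trace_sum, smul_eq_mul]
    refine Finset.sum_congr rfl fun g _ => ?_
    rw [hT, pow_two, map_mul, Matrix.trace, Fintype.sum_prod_type, Matrix.trace]
    simp only [Matrix.diag_apply, Matrix.submatrix_apply, Matrix.mul_apply, K,
      Matrix.kroneckerMap_apply, Prod.swap, id]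
    rw [Finset.sum_comm]
  rw [← hTPtr]
  exact trace_involution_mul hP hTT hTP htr

/-- The Frobenius–Schur indicator of an irreducible representation of the symmetric group. -/
def indicator (R : Irrep n) : ℂ :=
  (Nat.card (Perm (Fin n)) : ℂ)⁻¹ * ∑ σ : Perm (Fin n), chi R (σ ^ 2)

theorem indicator_eq_one_or_neg_one (R : Irrep n) : indicator R = 1 ∨ indicator R = -1 := by
  let b := Module.finBasis ℂ R.rep
  let A : Perm (Fin n) →* Matrix _ _ ℂ :=
    (LinearMap.toMatrixAlgEquiv b).toMulEquiv.toMonoidHom.comp R.rep.ρ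
  have hA : ∀ g, (A g).trace = chi R g := fun g =>
    (LinearMap.trace_eq_matrix_trace ℂ b (R.rep.ρ g)).symm
  have h := frobeniusSchur_matrix A
  simp only [hA] at h
  refine h ?_
  rw [sum_chi_mul_chi, if_pos rfl, inv_mul_cancel₀ (card_perm_ne_zero n)]

/-- The number of square roots in terms of Frobenius–Schur indicators. -/
theorem card_sqrt_eq_sum_indicator (τ : Perm (Fin n)) :
    ((Finset.univ.filter fun σ : Perm (Fin n) => σ ^ 2 = τ).card : ℂ) =
      ∑ R : Irrep n, indicator R * chi R τ := by
  have hf : ∀ x g : Perm (Fin n),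
      ((Finset.univ.filter fun σ : Perm (Fin n) => σ ^ 2 = x * g * x⁻¹).card : ℂ) =
        ((Finset.univ.filter fun σ : Perm (Fin n) => σ ^ 2 = g).card : ℂ) := fun x g => by
    congr 1
    refine Finset.card_equiv (MulAut.conj x⁻¹).toEquiv fun y => ?_
    have : (MulAut.conj x⁻¹).toEquiv y = x⁻¹ * y * x⁻¹⁻¹ := rfl
    simp only [Finset.mem_filter, Finset.mem_univ, true_and, this, conj_pow]
    rw [mul_inv_eq_iff_eq_mul, inv_mul_eq_iff_eq_mul, ← mul_assoc, eq_mul_inv_iff_mul_eq]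
  rw [classFunction_expansion (f := fun τ =>
    ((Finset.univ.filter fun σ : Perm (Fin n) => σ ^ 2 = τ).card : ℂ)) hf τ]
  refine Finset.sum_congr rfl fun R _ => ?_
  rw [indicator]
  congr 2
  simp only [Finset.card_filter, Nat.cast_sum, Finset.sum_mul]
  rw [Finset.sum_comm]
  simp

/-! ### Restriction from `S_{n+1}` to `S_n` -/

/-- The embedding of `S_n` in `S_{n+1}` as the stabiliser of `0`. -/
def stabEmb (n : ℕ) : Perm (Fin n) →* Perm (Fin (n + 1)) :=
  Perm.viaEmbeddingHom (Fin.succEmb n)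

theorem exists_stabEmb_eq {h : Perm (Fin (n + 1))} (h0 : h 0 = 0) : ∃ k, stabEmb n k = h := by
  obtain ⟨⟨p, k⟩, rfl⟩ := Perm.decomposeFin.symm.surjective h
  rw [Perm.decomposeFin_symm_apply_zero] at h0
  subst h0
  refine ⟨k, Equiv.ext fun x => ?_⟩
  refine Fin.cases ?_ (fun i => ?_) x
  · rw [Perm.decomposeFin_symm_apply_zero]
    refine Perm.viaEmbedding_apply_of_notMem _ _ _ ?_
    simp
  · rw [Perm.decomposeFin_symm_apply_succ, swap_self, refl_apply]
    exact Perm.viaEmbedding_apply k (Fin.succEmb n) i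

/-- The multiplicity of an irreducible representation of `S_n` in the restriction of an
irreducible representation of `S_{n+1}`. -/
def branching (V : Irrep (n + 1)) (W : Irrep n) : ℕ :=
  Module.finrank ℂ (W.rep ⟶ FDRep.of (V.rep.ρ.comp (stabEmb n)))

theorem branching_eq (V : Irrep (n + 1)) (W : Irrep n) :
    (branching V W : ℂ) =
      (Nat.card (Perm (Fin n)) : ℂ)⁻¹ * ∑ h, chi V (stabEmb n h) * chi W h :=
  finrank_hom_eq _ _

theorem chi_stabEmb (V : Irrep (n + 1)) (h : Perm (Fin n)) :
    chi V (stabEmb n h) = ∑ W, (branching V W : ℂ) * chi W h := by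
  simp only [branching_eq]
  exact classFunction_expansion (f := fun h => chi V (stabEmb n h))
    (fun x g => by simp only [map_mul, map_inv, chi_conj]) h

/-- Otherwise `χ^V` would vanish at `1`, making `V` zero-dimensional and contradicting that its
character has norm one. -/
theorem exists_branching_ne_zero (V : Irrep (n + 1)) : ∃ W, branching V W ≠ 0 := by
  by_contra! hV
  have h0 : ∀ h, chi V (stabEmb n h) = 0 := fun h => by simp [chi_stabEmb, hV]
  have h1 : V.rep.character 1 = 0 := by simpa [chi] using h0 1
  have h2 : ∀ g, chi V g = 0 := fun g => by
    have hs : Subsingleton V.rep := by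
      rw [FDRep.char_one] at h1
      exact Module.finrank_zero_iff.mp (by exact_mod_cast h1)
    have : V.rep.ρ g = 0 := LinearMap.ext fun v => Subsingleton.elim _ _
    simp [chi, FDRep.character, this]
  have h3 := sum_chi_mul_chi V V
  simp only [h2, if_pos, mul_zero, Finset.sum_const_zero] at h3
  exact card_perm_ne_zero (n + 1) h3.symm

/-- The number of elements of the subgroup `S_n` conjugating `y` to itself and to its inverse
agree. -/
theorem card_stab_conj_inv (y : Perm (Fin (n + 1))) :
    (Finset.univ.filter fun h : Perm (Fin n) => stabEmb n h * y = y * stabEmb n h).card =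
      (Finset.univ.filter fun h : Perm (Fin n) => y * stabEmb n h * y = stabEmb n h).card := by
  obtain ⟨k, hk0, hk⟩ := exists_conj_inv_of_fixed y 0
  obtain ⟨k, rfl⟩ := exists_stabEmb_eq hk0
  -- Since `k` inverts `y` and lies in `S_n`, translation by `k⁻¹` exchanges the elements
  -- centralizing `y` with those inverting it.
  refine Finset.card_equiv (Equiv.mulRight k⁻¹) fun h => ?_
  simp only [Finset.mem_filter, Finset.mem_univ, true_and, Equiv.coe_mulRight, map_mul, map_inv]
  have hk' : (stabEmb n k)⁻¹ * y = y⁻¹ * (stabEmb n k)⁻¹ := by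
    have h1 := congrArg (·⁻¹) (mul_inv_eq_iff_eq_mul.mp hk)
    simpa using h1.symm
  have e : y * (stabEmb n h * (stabEmb n k)⁻¹) * y =
      y * stabEmb n h * y⁻¹ * (stabEmb n k)⁻¹ := by
    simp only [mul_assoc, hk']
  rw [e, mul_left_inj, mul_inv_eq_iff_eq_mul, eq_comm]

theorem sum_card_centralizer_eq_sum_card_sqrt :
    ∑ h : Perm (Fin n), (Finset.univ.filter fun x : Perm (Fin (n + 1)) =>
        x * stabEmb n h = stabEmb n h * x).card =
      ∑ h : Perm (Fin n),
        (Finset.univ.filter fun x : Perm (Fin (n + 1)) => x ^ 2 = stabEmb n (h ^ 2)).card := by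
  have h1 : ∀ h : Perm (Fin n),
      (Finset.univ.filter fun x : Perm (Fin (n + 1)) => x ^ 2 = stabEmb n (h ^ 2)).card =
        (Finset.univ.filter fun y : Perm (Fin (n + 1)) =>
          y * stabEmb n h * y = stabEmb n h).card := fun h => by
    -- Substituting `x = h y` turns `x^2 = h^2` into `y h y = h`, which says that `h` conjugates `y`
    -- to `y⁻¹`.
    refine Finset.card_equiv (Equiv.mulLeft (stabEmb n h)⁻¹) fun x => ?_
    simp only [Finset.mem_filter, Finset.mem_univ, true_and, Equiv.coe_mulLeft, pow_two, map_mul,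
      mul_assoc]
    rw [inv_mul_eq_iff_eq_mul, mul_inv_cancel_left]
  simp only [h1, Finset.card_filter]
  rw [Finset.sum_comm, Finset.sum_comm (γ := Perm (Fin n))]
  refine Finset.sum_congr rfl fun y _ => ?_
  rw [← Finset.card_filter, ← Finset.card_filter, ← card_stab_conj_inv]
  simp only [eq_comm]

theorem sum_branching_sq (V : Irrep (n + 1)) :
    ∑ W, (branching V W : ℂ) ^ 2 =
      (Nat.card (Perm (Fin n)) : ℂ)⁻¹ * ∑ h, chi V (stabEmb n h) * chi V (stabEmb n h) := by
  calc ∑ W, (branching V W : ℂ) ^ 2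
      = ∑ W, (branching V W : ℂ) *
          ((Nat.card (Perm (Fin n)) : ℂ)⁻¹ * ∑ h, chi V (stabEmb n h) * chi W h) := by
        simp only [pow_two, ← branching_eq]
    _ = (Nat.card (Perm (Fin n)) : ℂ)⁻¹ *
          ∑ h, chi V (stabEmb n h) * ∑ W, (branching V W : ℂ) * chi W h := by
        simp only [Finset.mul_sum]
        rw [Finset.sum_comm]
        refine Finset.sum_congr rfl fun h _ => Finset.sum_congr rfl fun W _ => by ring
    _ = _ := by simp only [← chi_stabEmb]

theorem sum_branching_indicator (V : Irrep (n + 1)) :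
    ∑ W, (branching V W : ℂ) * indicator W =
      (Nat.card (Perm (Fin n)) : ℂ)⁻¹ * ∑ h, chi V (stabEmb n (h ^ 2)) := by
  simp only [chi_stabEmb, indicator, Finset.mul_sum]
  rw [Finset.sum_comm]
  refine Finset.sum_congr rfl fun h _ => Finset.sum_congr rfl fun W _ => by ring

/-- All irreducible representations of the symmetric groups are of real type. -/
theorem indicator_eq_one : ∀ {n : ℕ} (R : Irrep n), indicator R = 1
  | 0, R => by
    -- For the trivial group the indicator is the dimension, which cannot be `-1`.
    have h : indicator R = ((Module.finrank ℂ R.rep : ℕ) : ℂ) := by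
      rw [indicator, ← FDRep.char_one]
      simp [chi, Subsingleton.elim _ (1 : Perm (Fin 0))]
    refine (indicator_eq_one_or_neg_one R).resolve_right fun h' => ?_
    rw [h] at h'
    have : ((Module.finrank ℂ R.rep : ℕ) : ℤ) = -1 := by exact_mod_cast h'
    omega
  | n + 1, V => by
    have hε : ∀ R : Irrep (n + 1), ∃ ε : ℤ, (ε = 1 ∨ ε = -1) ∧ indicator R = ε := fun R => by
      rcases indicator_eq_one_or_neg_one R with h | h
      · exact ⟨1, Or.inl rfl, by simp [h]⟩
      · exact ⟨-1, Or.inr rfl, by simp [h]⟩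
    choose ε hε1 hε using hε
    have key : ∑ R : Irrep (n + 1), ∑ W : Irrep n, (branching R W : ℂ) ^ 2 =
        ∑ R : Irrep (n + 1), ∑ W : Irrep n, indicator R * branching R W := by
      have h1 : ∀ R : Irrep (n + 1), ∑ W : Irrep n, indicator R * branching R W =
          indicator R * ((Nat.card (Perm (Fin n)) : ℂ)⁻¹ * ∑ h, chi R (stabEmb n (h ^ 2))) :=
        fun R => by
          rw [← sum_branching_indicator, ← Finset.mul_sum]
          simp only [indicator_eq_one (n := n), mul_one]
      simp only [h1, sum_branching_sq]
      simp only [mul_left_comm (indicator _), ← Finset.mul_sum]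
      congr 1
      simp only [Finset.mul_sum]
      rw [Finset.sum_comm]
      conv_rhs => rw [Finset.sum_comm]
      simp only [sum_chi_mul_chi_column, ← card_sqrt_eq_sum_indicator]
      exact_mod_cast sum_card_centralizer_eq_sum_card_sqrt
    -- A natural number satisfies `m ≤ m^2`, so each term is nonnegative for either sign.
    have hnonneg : ∀ (R : Irrep (n + 1)) (W : Irrep n),
        0 ≤ (branching R W : ℤ) ^ 2 - ε R * branching R W := fun R W => by
      have hb : (0 : ℤ) ≤ branching R W := Int.natCast_nonneg _
      have hb2 : (branching R W : ℤ) ≤ (branching R W : ℤ) ^ 2 :=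
        Int.le_self_sq _
      rcases hε1 R with h | h <;> rw [h] <;> linarith
    have key' : ∑ R : Irrep (n + 1), ∑ W : Irrep n,
        ((branching R W : ℤ) ^ 2 - ε R * branching R W) = 0 := by
      simp only [hε] at key
      simp only [Finset.sum_sub_distrib, sub_eq_zero]
      exact_mod_cast key
    obtain ⟨W, hW⟩ := exists_branching_ne_zero V
    have h0 := (Finset.sum_eq_zero_iff_of_nonneg
      fun R _ => Finset.sum_nonneg fun W _ => hnonneg R W).mp key' V (Finset.mem_univ _)
    have h1 := (Finset.sum_eq_zero_iff_of_nonneg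
      fun W _ => hnonneg V W).mp h0 W (Finset.mem_univ _)
    rcases hε1 V with h | h
    · rw [hε, h, Int.cast_one]
    · rw [h] at h1
      have : 0 < (branching V W : ℤ) := by exact_mod_cast Nat.pos_of_ne_zero hW
      nlinarith

/-- The number of square roots of a permutation is the sum of the irreducible characters. -/
theorem card_sqrt_eq_sum_chi (τ : Perm (Fin n)) :
    ((Finset.univ.filter fun σ : Perm (Fin n) => σ ^ 2 = τ).card : ℂ) = ∑ R, chi R τ := by
  rw [card_sqrt_eq_sum_indicator]
  simp only [indicator_eq_one, one_mul]

/-! ### The trace of the colour exchange -/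

theorem card_perm_eq (n : ℕ) : (Nat.card (Perm (Fin n)) : ℂ) = (n ! : ℂ) := by
  rw [Nat.card_eq_fintype_card, Fintype.card_perm, Fintype.card_fin]

/-- Two-sided multiplication by diagonal group elements, summed over the group. -/
def biaverage (n : ℕ) : TripleAlgebra n →ₗ[ℂ] TripleAlgebra n :=
  ∑ γ₁ : Perm (Fin n), ∑ γ₂ : Perm (Fin n),
    LinearMap.mulLeft ℂ (MonoidAlgebra.single (fun _ => γ₁) 1) ∘ₗ
      LinearMap.mulRight ℂ (MonoidAlgebra.single (fun _ => γ₂) 1)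

theorem biaverage_single (σ : Fin 3 → Perm (Fin n)) :
    biaverage n (MonoidAlgebra.single σ 1) = graphElement σ := by
  simp only [biaverage, graphElement, LinearMap.sum_apply, LinearMap.comp_apply,
    LinearMap.mulLeft_apply, LinearMap.mulRight_apply, MonoidAlgebra.single_mul_single, mul_one]
  refine Finset.sum_congr rfl fun γ₁ _ => Finset.sum_congr rfl fun γ₂ _ => ?_
  congr 1

theorem biaverage_mem (x : TripleAlgebra n) : biaverage n x ∈ graphSpace n := by
  have h : (⊤ : Submodule ℂ (TripleAlgebra n)) ≤ (graphSpace n).comap (biaverage n) := by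
    rw [← (MonoidAlgebra.basis (Fin 3 → Perm (Fin n)) ℂ).span_eq, Submodule.span_le]
    rintro _ ⟨σ, rfl⟩
    rw [MonoidAlgebra.basis_apply, SetLike.mem_coe, Submodule.mem_comap, biaverage_single]
    exact Submodule.subset_span ⟨σ, rfl⟩
  exact h Submodule.mem_top

theorem graphElement_mul (γ₁ γ₂ : Perm (Fin n)) (σ : Fin 3 → Perm (Fin n)) :
    graphElement (fun i => γ₁ * σ i * γ₂) = graphElement σ := by
  refine Fintype.sum_equiv (Equiv.mulRight γ₁) _ _ fun x => ?_
  refine Fintype.sum_equiv (Equiv.mulLeft γ₂) _ _ fun y => ?_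
  simp [mul_assoc]

theorem biaverage_apply_of_mem {x : TripleAlgebra n} (hx : x ∈ graphSpace n) :
    biaverage n x = (n ! : ℂ) ^ 2 • x := by
  have h : graphSpace n ≤ LinearMap.eqLocus (biaverage n) ((n ! : ℂ) ^ 2 • LinearMap.id) := by
    refine Submodule.span_le.mpr ?_
    rintro _ ⟨σ, rfl⟩
    change biaverage n (graphElement σ) = (n ! : ℂ) ^ 2 • graphElement σ
    conv_lhs => rw [graphElement]
    simp only [map_sum, biaverage_single, graphElement_mul, Finset.sum_const, Finset.card_univ,
      Fintype.card_perm, Fintype.card_fin, ← Nat.cast_smul_eq_nsmul ℂ, smul_smul, pow_two]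
  exact h hx

/-- In the basis of group elements, each diagonal entry counts the pairs of multipliers for which
the permuted triple returns to itself. -/
theorem trace_slotPerm_biaverage (α : Perm (Fin 3)) :
    LinearMap.trace ℂ (TripleAlgebra n) (slotPerm n α ∘ₗ biaverage n) =
      (Nat.card {t : (Fin 3 → Perm (Fin n)) × Perm (Fin n) × Perm (Fin n) //
        (fun i => t.2.1 * t.1 (α⁻¹ i) * t.2.2) = t.1} : ℂ) := by
  classical
  rw [LinearMap.trace_eq_matrix_trace ℂ (MonoidAlgebra.basis (Fin 3 → Perm (Fin n)) ℂ),
    Matrix.trace]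
  have h : ∀ σ : Fin 3 → Perm (Fin n),
      (LinearMap.toMatrix (MonoidAlgebra.basis (Fin 3 → Perm (Fin n)) ℂ)
        (MonoidAlgebra.basis (Fin 3 → Perm (Fin n)) ℂ) (slotPerm n α ∘ₗ biaverage n)).diag σ =
        ∑ γ : Perm (Fin n) × Perm (Fin n),
          if (fun i => γ.1 * σ (α⁻¹ i) * γ.2) = σ then (1 : ℂ) else 0 := fun σ => by
    rw [Matrix.diag_apply, LinearMap.toMatrix_apply, MonoidAlgebra.basis_apply,
      LinearMap.comp_apply, biaverage_single, Fintype.sum_prod_type]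
    simp only [graphElement, map_sum, slotPerm_single]
    simp only [Finsupp.finsetSum_apply]
    exact Finset.sum_congr rfl fun γ₁ _ => Finset.sum_congr rfl fun γ₂ _ => Finsupp.single_apply
  simp only [h]
  rw [Nat.card_eq_fintype_card, Fintype.card_subtype, Finset.card_filter, Nat.cast_sum,
    Fintype.sum_prod_type]
  simp

/-- Fixed points of the colour exchange up to simultaneous left and right multiplication. -/
def exchangeFixedEquiv (n : ℕ) :
    {t : (Fin 3 → Perm (Fin n)) × Perm (Fin n) × Perm (Fin n) //
      (fun i => t.2.1 * t.1 ((swap 0 1 : Perm (Fin 3))⁻¹ i) * t.2.2) = t.1} ≃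
    Perm (Fin n) × {t : Perm (Fin n) × Perm (Fin n) // t.2 * t.1 ^ 2 = t.1 ^ 2 * t.2} where
  toFun t := ⟨t.1.1 2, ⟨(t.1.2.1, t.1.1 0 * (t.1.1 2)⁻¹), by
    obtain ⟨⟨σ, γ, δ⟩, h⟩ := t
    have h0 : γ * σ 1 * δ = σ 0 := congrFun h 0
    have h1 : γ * σ 0 * δ = σ 1 := congrFun h 1
    have h2 : γ * σ 2 * δ = σ 2 := congrFun h 2
    have hδ : δ = (σ 2)⁻¹ * γ⁻¹ * σ 2 := by
      rw [mul_assoc, eq_inv_mul_iff_mul_eq, eq_inv_mul_iff_mul_eq, ← mul_assoc, h2]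
    -- Going around the exchanged slots twice shows that conjugation by `γ^2` fixes `σ 0 * (σ 2)⁻¹`;
    -- `σ 2` itself remains free.
    rw [← h1, hδ] at h0
    change σ 0 * (σ 2)⁻¹ * γ ^ 2 = γ ^ 2 * (σ 0 * (σ 2)⁻¹)
    conv_lhs => rw [← h0]
    simp only [pow_two, mul_assoc, inv_mul_cancel_left, mul_inv_cancel_left, inv_mul_cancel,
      mul_one]⟩⟩
  invFun t := ⟨(![t.2.1.2 * t.1, t.2.1.1 * t.2.1.2 * t.2.1.1⁻¹ * t.1, t.1],
      t.2.1.1, t.1⁻¹ * t.2.1.1⁻¹ * t.1), by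
    obtain ⟨c, ⟨γ, a⟩, h⟩ := t
    have h' : γ ^ 2 * a * (γ ^ 2)⁻¹ = a := by rw [← h]; simp
    funext i
    fin_cases i
    · change γ * (γ * a * γ⁻¹ * c) * (c⁻¹ * γ⁻¹ * c) = a * c
      conv_rhs => rw [← h']
      simp only [pow_two, mul_assoc, mul_inv_rev, mul_inv_cancel_left]
    · change γ * (a * c) * (c⁻¹ * γ⁻¹ * c) = γ * a * γ⁻¹ * c
      group
    · change γ * c * (c⁻¹ * γ⁻¹ * c) = c
      group⟩
  left_inv t := by
    obtain ⟨⟨σ, γ, δ⟩, h⟩ := t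
    have h1 : γ * σ 0 * δ = σ 1 := congrFun h 1
    have h2 : γ * σ 2 * δ = σ 2 := congrFun h 2
    have hδ : (σ 2)⁻¹ * γ⁻¹ * σ 2 = δ := by
      rw [mul_assoc, inv_mul_eq_iff_eq_mul, inv_mul_eq_iff_eq_mul, ← mul_assoc, h2]
    refine Subtype.ext (Prod.ext ?_ (Prod.ext rfl hδ))
    funext i
    fin_cases i
    · exact inv_mul_cancel_right _ _
    · change γ * (σ 0 * (σ 2)⁻¹) * γ⁻¹ * σ 2 = σ 1
      rw [← h1, ← hδ]
      group
    · rfl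
  right_inv t := by
    obtain ⟨c, ⟨γ, a⟩, h⟩ := t
    refine Prod.ext rfl (Subtype.ext (Prod.ext rfl ?_))
    exact mul_inv_cancel_right a c

theorem S21_eq_sum_card_centralizer (n : ℕ) :
    S21 n = 1 / (n ! : ℂ) * ∑ γ : Perm (Fin n),
      ((Finset.univ.filter fun a : Perm (Fin n) => a * γ ^ 2 = γ ^ 2 * a).card : ℂ) := by
  classical
  have hN : (n ! : ℂ) ≠ 0 := by exact_mod_cast n.factorial_ne_zero
  let s := slotPerm n (swap 0 1)
  let f : TripleAlgebra n →ₗ[ℂ] TripleAlgebra n := ((n ! : ℂ) ^ 2)⁻¹ • (s ∘ₗ biaverage n)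
  have hf : ∀ x, f x ∈ graphSpace n := fun x =>
    Submodule.smul_mem _ _ (slotPerm_mem _ _ (biaverage_mem x))
  -- On `K(n)` the normalized average is the identity, and `f` maps everything into `K(n)`, so its
  -- full trace equals the trace on `K(n)`.
  have hres : (s.restrict (slotPerm_mem (swap 0 1)) : graphSpace n →ₗ[ℂ] graphSpace n) =
      f.restrict (fun x _ => hf x) := by
    refine LinearMap.ext fun x => Subtype.ext ?_
    change s x = ((n ! : ℂ) ^ 2)⁻¹ • s (biaverage n x)
    rw [biaverage_apply_of_mem x.2, map_smul, inv_smul_smul₀ (pow_ne_zero 2 hN)]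
  rw [S21, colorTrace, hres, LinearMap.trace_restrict_eq_of_forall_mem _ _ hf, map_smul,
    trace_slotPerm_biaverage, Nat.card_congr (exchangeFixedEquiv n), Nat.card_prod,
    Nat.cast_mul, card_perm_eq, smul_eq_mul, Nat.card_eq_fintype_card, Fintype.card_subtype,
    Finset.card_filter, Fintype.sum_prod_type]
  simp only [Finset.card_filter, Nat.cast_sum]
  field_simp

/-! ### Sums over conjugacy classes -/

theorem isConj_tau_iff (σ : Perm (Fin n)) (p : n.Partition) :
    IsConj σ (tau p) ↔ σ.partition.parts = p.parts := by
  rw [Perm.partition_eq_of_isConj, Nat.Partition.ext_iff,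
    (exists_perm_of_partition p).choose_spec.symm]
  rfl

theorem existsUnique_isConj_tau (σ : Perm (Fin n)) : ∃! p : n.Partition, IsConj σ (tau p) := by
  refine ⟨⟨σ.partition.parts, fun h => σ.partition.parts_pos h, ?_⟩, ?_, fun q hq => ?_⟩
  · rw [σ.partition.parts_sum, Fintype.card_fin]
  · exact (isConj_tau_iff _ _).mpr rfl
  · exact Nat.Partition.ext ((isConj_tau_iff _ _).mp hq).symm

/-- The sum over conjugacy classes of a class function. -/
theorem sum_mul_card_centralizer {f : Perm (Fin n) → ℂ} (hf : ∀ x g, f (x * g * x⁻¹) = f g) :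
    1 / (n ! : ℂ) * ∑ τ, f τ *
        ((Finset.univ.filter fun a : Perm (Fin n) => a * τ = τ * a).card : ℂ) =
      ∑ p : n.Partition, f (tau p) := by
  classical
  have hN : (n ! : ℂ) ≠ 0 := by exact_mod_cast n.factorial_ne_zero
  -- For fixed `τ` only the partition of its own class contributes, with the centralizer order; for
  -- fixed `p`, each `x` determines exactly one `τ`.
  let c : Perm (Fin n) → n.Partition → ℕ := fun τ p =>
    (Finset.univ.filter fun x : Perm (Fin n) => x * tau p = τ * x).card
  have hc : ∀ τ, (Finset.univ.filter fun a : Perm (Fin n) => a * τ = τ * a).card =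
      ∑ p, c τ p := fun τ => by
    obtain ⟨p, hp, hp'⟩ := existsUnique_isConj_tau τ
    rw [Finset.sum_eq_single p]
    · obtain ⟨y, hy⟩ := isConj_iff.mp hp
      refine Finset.card_equiv (Equiv.mulRight y⁻¹) fun x => ?_
      simp only [Finset.mem_filter, Finset.mem_univ, true_and, Equiv.coe_mulRight, ← hy]
      rw [← mul_assoc τ, ← mul_left_inj y⁻¹]
      simp only [mul_assoc, inv_mul_cancel_left]
    · intro q _ hq
      rw [Finset.card_eq_zero, Finset.filter_eq_empty_iff]
      intro x _ hx
      exact hq (hp' q (isConj_iff.mpr ⟨x⁻¹, by rw [inv_inv, mul_assoc, ← hx]; simp⟩))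
    · exact fun h => absurd (Finset.mem_univ p) h
  have hs : ∀ p, ∑ τ, f τ * (c τ p : ℂ) = n ! * f (tau p) := fun p => by
    calc ∑ τ, f τ * (c τ p : ℂ)
        = ∑ τ, ∑ x : Perm (Fin n), if τ = x * tau p * x⁻¹ then f τ else 0 := by
          refine Finset.sum_congr rfl fun τ _ => ?_
          simp only [c, Finset.card_filter, Nat.cast_sum, Finset.mul_sum]
          refine Finset.sum_congr rfl fun x _ => ?_
          have : x * tau p = τ * x ↔ τ = x * tau p * x⁻¹ := by rw [eq_mul_inv_iff_mul_eq, eq_comm]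
          simp [this]
      _ = _ := by
          rw [Finset.sum_comm]
          simp [hf, Fintype.card_perm]
  simp only [hc, Nat.cast_sum, Finset.mul_sum]
  rw [Finset.sum_comm]
  simp only [← Finset.mul_sum, hs]
  rw [← mul_assoc, one_div, inv_mul_cancel₀ hN, one_mul]

theorem sum_kron_eq (S : Irrep n) :
    ∑ R : Irrep n, (kron R R S : ℂ) = ∑ p : n.Partition, charTable n S p := by
  have h := sum_mul_card_centralizer (f := chi S) (chi_conj S)
  refine Eq.trans ?_ h
  simp only [kron, finrank_hom_eq, FDRep.char_tensor, Pi.mul_apply]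
  rw [← Finset.mul_sum, Finset.sum_comm, card_perm_eq, one_div]
  congr 1
  refine Finset.sum_congr rfl fun g _ => ?_
  rw [← sum_chi_mul_chi_column, Finset.mul_sum]
  exact Finset.sum_congr rfl fun R _ => mul_comm _ _

theorem S21_eq_sum_sq (n : ℕ) :
    S21 n = 1 / (n ! : ℂ) * ∑ R : Irrep n, ∑ σ : Perm (Fin n), chi R (σ ^ 2) ^ 2 := by
  rw [S21_eq_sum_card_centralizer, Finset.sum_comm]
  simp only [← sum_chi_mul_chi_column, pow_two]

theorem S21_eq_sum_charTable (n : ℕ) :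
    S21 n = ∑ R : Irrep n, ∑ p : n.Partition, charTable n R p := by
  classical
  have h := sum_mul_card_centralizer (f := fun τ : Perm (Fin n) => ∑ R, chi R τ)
    (fun x g => by simp only [chi_conj])
  refine Eq.trans ?_ (h.trans Finset.sum_comm)
  rw [S21_eq_sum_card_centralizer]
  congr 1
  -- Replacing the character sum by the number of square roots of `τ` groups the sum over `γ` by `τ
  -- = γ^2`.
  simp only [← card_sqrt_eq_sum_chi, Finset.card_filter _ (Finset.univ : Finset (Perm (Fin n)))]
  simp only [Nat.cast_sum, Nat.cast_ite, Nat.cast_one, Nat.cast_zero, Finset.sum_mul, ite_mul,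
    one_mul, zero_mul]
  conv_rhs => rw [Finset.sum_comm]
  simp

end SymChar

end

theorem mainTheorem12 (n : ℕ) :
    SymChar.S21 n =
        1 / (n ! : ℂ) * ∑ R : SymChar.Irrep n, ∑ σ : Perm (Fin n), SymChar.chi R (σ ^ 2) ^ 2 ∧
      SymChar.S21 n =
        ∑ R : SymChar.Irrep n, ∑ S : SymChar.Irrep n, (SymChar.kron R R S : ℂ) ∧
      SymChar.S21 n =
        ∑ R : SymChar.Irrep n, ∑ p : n.Partition, SymChar.charTable n R p ∧
      (∀ S : SymChar.Irrep n,
        ∑ R : SymChar.Irrep n, (SymChar.kron R R S : ℂ) =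
          ∑ p : n.Partition, SymChar.charTable n S p) ∧
      (∀ τ : Perm (Fin n),
        ((Finset.univ.filter fun σ : Perm (Fin n) => σ ^ 2 = τ).card : ℂ) =
          ∑ S : SymChar.Irrep n, SymChar.chi S τ) := by
  exact ⟨SymChar.S21_eq_sum_sq n,
    (SymChar.S21_eq_sum_charTable n).trans
      ((Finset.sum_congr rfl fun S _ => (SymChar.sum_kron_eq S).symm).trans Finset.sum_comm),
    SymChar.S21_eq_sum_charTable n, SymChar.sum_kron_eq, SymChar.card_sqrt_eq_sum_chi⟩
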